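/- Let $k\ge 2$. The $k$-trees are the finite graphs obtained recursively as follows: the complete graph $K_k$ is a $k$-tree; if $T$ is a $k$-tree, then so is the graph obtained from $T$ by joining a new vertex to all vertices of some $k$-clique of $T$; there are no other $k$-trees. A sub-$k$-tree of a $k$-tree $T$ is a subgraph of $T$ that is itself a $k$-tree. For a $k$-clique $C$ of $T$, let $S(T;C)$ be the set of sub-$k$-trees of $T$ that contain $C$, and let $$\mu(T;C)=\frac{1}{|S(T;C)|}\sum_{X\in S(T;C)}|V(X)|$$ be the local mean sub-$k$-tree order of $T$ at $C$. The degree of $C$ is the number of $(k+1)$-cliques of $T$ that contain $C$. Let $T$ be a $k$-tree of order $n$. If $n\ne k$ and $n\neq k+2$, and $C$ is a $k$-clique of $T$ that maximizes $\mu(T;C)$ among all $k$-cliques of $T$, then $C$ has degree $1$. If $n=k+2$, then every $k$-clique $C$ of $T$ satisfies $\mu(T;C)=k+1$. -/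

import Mathlib

/-- A subgraph `X` of `G` is a `k`-tree: it is a complete graph on `k` vertices, or it arises from a
`k`-tree by joining a new vertex `v` to all vertices of some `k`-clique `s`.  (This depends on the
vertices and edges of `X` only, not on the surrounding graph `G`, since all the
intermediate `k`-trees of the construction are subgraphs of `X`.) -/
inductive SimpleGraph.Subgraph.IsKTree {V : Type*} {G : SimpleGraph V} (k : ℕ) :
    G.Subgraph → Prop
  | base (X : G.Subgraph) (s : Finset V) (hcard : s.card = k) (hverts : X.verts = ↑s)
      (hadj : ∀ a b, X.Adj a b ↔ a ∈ s ∧ b ∈ s ∧ a ≠ b) : IsKTree k X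
  | step (X Y : G.Subgraph) (hX : IsKTree k X) (s : Finset V) (v : V)
      (hsub : ↑s ⊆ X.verts) (hcard : s.card = k)
      (hclique : ∀ a ∈ s, ∀ b ∈ s, a ≠ b → X.Adj a b)
      (hv : v ∉ X.verts) (hverts : Y.verts = insert v X.verts)
      (hadj : ∀ a b, Y.Adj a b ↔ X.Adj a b ∨ (a = v ∧ b ∈ s) ∨ (a ∈ s ∧ b = v)) :
      IsKTree k Y

/-- The graph `G` is a `k`-tree. -/
def SimpleGraph.IsKTree {V : Type*} (k : ℕ) (G : SimpleGraph V) : Prop :=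
  (⊤ : G.Subgraph).IsKTree k

/-- `S(G; C)`: the sub-`k`-trees of `G` that contain the clique with vertex set `C`. -/
noncomputable def SimpleGraph.localSubKTrees {V : Type*} [Finite V] (k : ℕ) (G : SimpleGraph V)
    (C : Finset V) : Finset G.Subgraph :=
  (Set.toFinite
    {X : G.Subgraph | X.IsKTree k ∧ (⊤ : G.Subgraph).induce (C : Set V) ≤ X}).toFinset

/-- `N(G; C)`: the number of sub-`k`-trees of `G` that contain `C`. -/
noncomputable def SimpleGraph.localNumber {V : Type*} [Finite V] (k : ℕ) (G : SimpleGraph V)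
    (C : Finset V) : ℕ :=
  (G.localSubKTrees k C).card

/-- `R(G; C)`: the total number of vertices in the sub-`k`-trees of `G` that contain `C`. -/
noncomputable def SimpleGraph.localTotal {V : Type*} [Finite V] (k : ℕ) (G : SimpleGraph V)
    (C : Finset V) : ℕ :=
  ∑ X ∈ G.localSubKTrees k C, X.verts.ncard

/-- `μ(G; C) = R(G; C) / N(G; C)`: the local mean sub-`k`-tree order of `G` at `C`. -/
noncomputable def SimpleGraph.localMean {V : Type*} [Finite V] (k : ℕ) (G : SimpleGraph V)
    (C : Finset V) : ℝ :=
  (G.localTotal k C : ℝ) / (G.localNumber k C : ℝ)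

/-- The degree of a `k`-clique `C`: the number of `(k + 1)`-cliques that contain `C`. -/
noncomputable def SimpleGraph.cliqueDegree {V : Type*} (k : ℕ) (G : SimpleGraph V)
    (C : Finset V) : ℕ :=
  {B : Finset V | G.IsNClique (k + 1) B ∧ C ⊆ B}.ncard

/-!
Let `C` be a `k`-clique of the `k`-tree `T`. Sub-`k`-trees are induced subgraphs
(`IsKTree.isKTree_iff`), so they are handled as vertex sets, and local means are measured by the
*excess*, the number of vertices outside `C`.

A `k`-tree can be built up starting from any of its cliques with at least `k` vertices
(`IsKTreeOn.rooted_induction`). Two facts follow. First, the sizes of the sub-`k`-trees over a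
clique have no gaps, whence a family of `N` of them has mean excess at most `(N - 1) / 2`
(`excessTotal_le`). Second, a `(k + 1)`-clique `B` splits the remaining vertices into parts, one
attached to each `k`-clique `B \ {b}` (`IsKTreeOn.exists_isPartition`), and the sub-`k`-trees that
contain `B` are the free combinations of sub-`k`-trees over the `B \ {b}` that avoid `b`
(`IsPartition.kTreeFamily_eq_image`). Hence numbers multiply and mean excesses add.

Suppose that `C` has two extensions `B = C ∪ {v}` and `C ∪ {w}` to `(k + 1)`-cliques. Among the
`u ∈ C` choose one with the fewest sub-`k`-trees over `D = B \ {u}` that avoid `u`: let `x` be this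
number and `q` the number for the other parts of `B` together, the one at `C` excluded. As `k ≥ 2`,
`x ≤ q`. The local mean at `D` does not exceed the one at `C` exactly when
`(1 + p₁ + p') * (1 + q * NA) ≤ (1 + a + p') * (1 + x * q)`, where `p₁`, `p'`, `a` are the mean
excesses that go with `x`, `q` and the number `NA` of sub-`k`-trees over `C` that avoid `v`
(`IsBranch.mean_le`). In the analogous inequality for `w` the branches exchange their roles. The
product of the two is essentially free of the means, and, small cases and very unequal branches
aside, it contradicts `x ^ 2 ≤ x * q` and the analogous bound for `w`; in the end, both can only
hold if all the factors are `1` (`eq_one_of_mean_le`), when `T` has only `k + 2`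
vertices. So a clique of degree at least two in a larger `k`-tree has a neighbouring clique with a
larger local mean.
-/

/-! ### Vertex sets that induce `k`-trees -/

namespace SimpleGraph

open scoped Classical

variable {V : Type*}

/-- The vertex set `W` induces a `k`-tree in `H`: it is a `k`-clique, or it arises from such a set
by adding a vertex whose neighbours in the set form a `k`-clique. -/
inductive IsKTreeOn (H : SimpleGraph V) (k : ℕ) : Finset V → Prop
  | base (W : Finset V) (hW : H.IsNClique k W) : IsKTreeOn H k W
  | step (W s : Finset V) (v : V) (hW : IsKTreeOn H k W) (hs : s ⊆ W) (hcl : H.IsNClique k s)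
      (hv : v ∉ W) (hadj : ∀ b ∈ W, H.Adj v b ↔ b ∈ s) : IsKTreeOn H k (insert v W)

variable {H : SimpleGraph V} {k : ℕ}

namespace IsKTreeOn

lemma le_card {W : Finset V} (h : H.IsKTreeOn k W) : k ≤ W.card := by
  induction h with
  | base W hW => exact hW.card_eq.ge
  | step W s v hW hs hcl hv hadj ih => rw [Finset.card_insert_of_notMem hv]; omega

lemma isNClique {W : Finset V} (h : H.IsKTreeOn k W) (hc : W.card = k) : H.IsNClique k W := by
  cases h with
  | base _ hW => exact hW
  | step W s v hW hs hcl hv hadj =>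
    rw [Finset.card_insert_of_notMem hv] at hc
    have := hW.le_card
    omega

lemma congr {H' : SimpleGraph V} {W : Finset V} (h : H.IsKTreeOn k W)
    (hH : ∀ a ∈ W, ∀ b ∈ W, H.Adj a b ↔ H'.Adj a b) : H'.IsKTreeOn k W := by
  induction h with
  | base W hW =>
    refine .base W ⟨fun a ha b hb hab => ?_, hW.card_eq⟩
    exact (hH a ha b hb).1 (hW.isClique ha hb hab)
  | step W s v hW hs hcl hv hadj ih =>
    refine .step W s v (ih fun a ha b hb => hH a (Finset.mem_insert_of_mem ha) b
      (Finset.mem_insert_of_mem hb)) hs ⟨fun a ha b hb hab => ?_, hcl.card_eq⟩ hv fun b hb => ?_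
    · exact (hH a (Finset.mem_insert_of_mem (hs ha)) b (Finset.mem_insert_of_mem (hs hb))).1
        (hcl.isClique ha hb hab)
    · rw [← hH v (Finset.mem_insert_self _ _) b (Finset.mem_insert_of_mem hb), hadj b hb]

/-- The neighbours of a newly added vertex. -/
lemma filter_adj_insert_self {W s : Finset V} {v : V} (hs : s ⊆ W)
    (hadj : ∀ b ∈ W, H.Adj v b ↔ b ∈ s) : (insert v W).filter (H.Adj v) = s := by
  ext b
  simp only [Finset.mem_filter, Finset.mem_insert]
  refine ⟨?_, fun hb => ⟨.inr (hs hb), (hadj b (hs hb)).2 hb⟩⟩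
  rintro ⟨rfl | hb, h⟩
  · exact (H.irrefl h).elim
  · exact (hadj b hb).1 h

lemma filter_adj_insert_of_mem {W s : Finset V} {v w : V} (hv : v ∉ W)
    (hadj : ∀ b ∈ W, H.Adj v b ↔ b ∈ s) (hw : w ∈ W) (hws : w ∈ s) :
    ((insert v W).filter (H.Adj w)).card = (W.filter (H.Adj w)).card + 1 := by
  rw [Finset.filter_insert, if_pos ((hadj w hw).2 hws).symm, Finset.card_insert_of_notMem]
  simp [hv]

lemma filter_adj_insert_of_notMem {W s : Finset V} {v w : V}
    (hadj : ∀ b ∈ W, H.Adj v b ↔ b ∈ s) (hw : w ∈ W) (hws : w ∉ s) :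
    (insert v W).filter (H.Adj w) = W.filter (H.Adj w) := by
  rw [Finset.filter_insert, if_neg fun h => hws ((hadj w hw).1 h.symm)]

lemma filter_adj_of_isNClique {m : ℕ} {W : Finset V} (hW : H.IsNClique m W) {v : V}
    (hv : v ∈ W) : W.filter (H.Adj v) = W.erase v := by
  ext b
  simp only [Finset.mem_filter, Finset.mem_erase]
  exact ⟨fun h => ⟨h.2.ne', h.1⟩, fun h => ⟨h.2, hW.isClique hv h.2 h.1.symm⟩⟩

/-- If the set before the last step is a `k`-clique, the last step yields a `(k + 1)`-clique. -/
lemma isNClique_insert {W s : Finset V} {v : V} (hs : s ⊆ W) (hcl : H.IsNClique k s)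
    (hadj : ∀ b ∈ W, H.Adj v b ↔ b ∈ s) (hc : W.card = k) :
    H.IsNClique (k + 1) (insert v W) := by
  obtain rfl : s = W := Finset.eq_of_subset_of_card_le hs (by rw [hc, hcl.card_eq])
  exact hcl.insert fun b hb => (hadj b hb).2 hb

/-- A `k`-tree with more than `k` vertices has minimum degree at least `k`. -/
lemma le_degree {W : Finset V} (h : H.IsKTreeOn k W) (hc : k < W.card) {v : V} (hv : v ∈ W) :
    k ≤ (W.filter (H.Adj v)).card := by
  induction h with
  | base W hW => exact absurd hW.card_eq hc.ne'
  | step W s w hW hs hcl hw hadj ih =>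
    rcases hW.le_card.eq_or_lt with hk | hk
    · have hcq := isNClique_insert hs hcl hadj hk.symm
      rw [filter_adj_of_isNClique hcq hv, Finset.card_erase_of_mem hv, hcq.card_eq]
      omega
    · rcases Finset.mem_insert.1 hv with rfl | hvW
      · rw [filter_adj_insert_self hs hadj, hcl.card_eq]
      · exact (ih hk hvW).trans (Finset.card_le_card
          (Finset.filter_subset_filter _ (Finset.subset_insert _ _)))

/-- Removing a vertex of degree `k` from a `k`-tree with more than `k` vertices leaves a `k`-tree,
and the neighbours of that vertex form a clique. -/
lemma erase {W : Finset V} (h : H.IsKTreeOn k W) (hc : k < W.card) {v : V} (hv : v ∈ W)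
    (hd : (W.filter (H.Adj v)).card = k) :
    H.IsKTreeOn k (W.erase v) ∧ H.IsNClique k (W.filter (H.Adj v)) := by
  induction h with
  | base W hW => exact absurd hW.card_eq hc.ne'
  | step W s w hW hs hcl hw hadj ih =>
    rcases hW.le_card.eq_or_lt with hk | hk
    · have hcq := isNClique_insert hs hcl hadj hk.symm
      have he : H.IsNClique k ((insert w W).erase v) := by
        refine ⟨hcq.isClique.subset (Finset.coe_subset.2 (Finset.erase_subset _ _)), ?_⟩
        rw [Finset.card_erase_of_mem hv, hcq.card_eq]; omega
      exact ⟨.base _ he, by rwa [filter_adj_of_isNClique hcq hv]⟩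
    · rcases Finset.mem_insert.1 hv with rfl | hvW
      · rw [filter_adj_insert_self hs hadj, Finset.erase_insert hw]
        exact ⟨hW, hcl⟩
      · have hne : w ≠ v := fun h => hw (h ▸ hvW)
        by_cases hvs : v ∈ s
        · have h1 := filter_adj_insert_of_mem hw hadj hvW hvs
          have h2 := hW.le_degree hk hvW
          omega
        · rw [filter_adj_insert_of_notMem hadj hvW hvs] at hd ⊢
          obtain ⟨h1, h2⟩ := ih hk hvW hd
          refine ⟨?_, h2⟩
          rw [Finset.erase_insert_of_ne hne]
          refine .step _ s w h1 (fun a ha => Finset.mem_erase.2 ⟨fun h => hvs (h ▸ ha), hs ha⟩)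
            hcl (fun h => hw (Finset.mem_of_mem_erase h))
            fun b hb => hadj b (Finset.mem_of_mem_erase hb)

/-- Every clique of a `k`-tree that is not everything misses a vertex of degree `k`. -/
lemma exists_degree_eq {W C : Finset V} (h : H.IsKTreeOn k W) (hc : k < W.card)
    (hC : H.IsClique (C : Set V)) (hCW : C ⊂ W) :
    ∃ v ∈ W, v ∉ C ∧ (W.filter (H.Adj v)).card = k := by
  induction h generalizing C with
  | base W hW => exact absurd hW.card_eq hc.ne'
  | step W s w hW hs hcl hw hadj ih =>
    rcases hW.le_card.eq_or_lt with hk | hk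
    · have hcq := isNClique_insert hs hcl hadj hk.symm
      obtain ⟨v, hv, hvC⟩ := Finset.exists_of_ssubset hCW
      refine ⟨v, hv, hvC, ?_⟩
      rw [filter_adj_of_isNClique hcq hv, Finset.card_erase_of_mem hv, hcq.card_eq]
      omega
    · by_cases hwC : w ∈ C
      · have hsW : s ⊂ W := by
          refine hs.ssubset_of_ne ?_
          rintro rfl
          exact hk.ne' hcl.card_eq
        obtain ⟨v, hv, hvs, hd⟩ := ih hk hcl.isClique hsW
        have hne : w ≠ v := fun h => hw (h ▸ hv)
        refine ⟨v, Finset.mem_insert_of_mem hv, fun hvC => ?_, ?_⟩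
        · exact hvs ((hadj v hv).1 (hC hwC hvC hne))
        · rwa [filter_adj_insert_of_notMem hadj hv hvs]
      · refine ⟨w, Finset.mem_insert_self _ _, hwC, ?_⟩
        rw [filter_adj_insert_self hs hadj, hcl.card_eq]

/-- A `k`-tree can be dismantled, one vertex at a time, down to any prescribed clique with at least
`k` vertices. -/
lemma exists_erase {W C : Finset V} (h : H.IsKTreeOn k W) (hkC : k ≤ C.card)
    (hC : H.IsClique (C : Set V)) (hCW : C ⊂ W) :
    ∃ v ∈ W, v ∉ C ∧ H.IsKTreeOn k (W.erase v) ∧ H.IsNClique k (W.filter (H.Adj v)) := by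
  have hc : k < W.card := hkC.trans_lt (Finset.card_lt_card hCW)
  obtain ⟨v, hv, hvC, hd⟩ := h.exists_degree_eq hc hC hCW
  exact ⟨v, hv, hvC, h.erase hc hv hd⟩

/-- A `k`-tree can be built up starting from any of its cliques with at least `k` vertices. -/
lemma rooted_induction {C : Finset V} (hkC : k ≤ C.card) (hC : H.IsClique (C : Set V))
    {P : Finset V → Prop} (hbase : P C)
    (hstep : ∀ X s v, H.IsKTreeOn k X → C ⊆ X → s ⊆ X → H.IsNClique k s → v ∉ X →
      (∀ b ∈ X, H.Adj v b ↔ b ∈ s) → P X → P (insert v X))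
    {W : Finset V} (h : H.IsKTreeOn k W) (hCW : C ⊆ W) : P W := by
  induction hn : W.card generalizing W with
  | zero =>
    obtain rfl := Finset.card_eq_zero.1 hn
    rwa [Finset.subset_empty.1 hCW] at hbase
  | succ n ih =>
    rcases hCW.eq_or_ssubset with rfl | hss
    · exact hbase
    obtain ⟨v, hv, hvC, h1, h2⟩ := h.exists_erase hkC hC hss
    have hCe : C ⊆ W.erase v := Finset.subset_erase.2 ⟨hCW, hvC⟩
    rw [← Finset.insert_erase hv]
    refine hstep _ _ v h1 hCe (fun b hb => ?_) h2 (Finset.notMem_erase _ _) (fun b hb => ?_)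
      (ih h1 hCe (by rw [Finset.card_erase_of_mem hv]; omega))
    · rw [Finset.mem_filter] at hb
      exact Finset.mem_erase.2 ⟨hb.2.ne', hb.1⟩
    · simp [Finset.mem_of_mem_erase hb]

/-- A `k`-tree contained in another `k`-tree is an induced subgraph. -/
lemma adj_of_le {T : SimpleGraph V} {U W : Finset V} (hT : T.IsKTreeOn k U) (hle : H ≤ T)
    (hW : H.IsKTreeOn k W) (hWU : W ⊆ U) {a b : V} (ha : a ∈ W) (hb : b ∈ W)
    (hab : T.Adj a b) : H.Adj a b := by
  induction hT generalizing W a b with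
  | base U hU =>
    have hk : W.card = k :=
      le_antisymm (hU.card_eq ▸ Finset.card_le_card hWU) hW.le_card
    exact (hW.isNClique hk).isClique ha hb hab.ne
  | step U s v hU hs hcl hv hadj ih =>
    by_cases hvW : v ∈ W
    · rcases hW.le_card.eq_or_lt with hk | hk
      · exact (hW.isNClique hk.symm).isClique ha hb hab.ne
      have hsub : W.filter (H.Adj v) ⊆ s := fun x hx => by
        rw [Finset.mem_filter] at hx
        rcases Finset.mem_insert.1 (hWU hx.1) with rfl | hxU
        · exact (H.irrefl hx.2).elim
        · exact (hadj x hxU).1 (hle hx.2)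
      have heq : W.filter (H.Adj v) = s :=
        Finset.eq_of_subset_of_card_le hsub (hcl.card_eq ▸ hW.le_degree hk hvW)
      have hnb : ∀ x ∈ W, T.Adj v x → H.Adj v x := fun x hx hvx => by
        rcases Finset.mem_insert.1 (hWU hx) with rfl | hxU
        · exact (T.irrefl hvx).elim
        · have := (hadj x hxU).1 hvx
          rw [← heq, Finset.mem_filter] at this
          exact this.2
      by_cases hav : a = v
      · subst hav; exact hnb b hb hab
      by_cases hbv : b = v
      · subst hbv; exact (hnb a ha hab.symm).symm
      refine ih (hW.erase hk hvW (heq ▸ hcl.card_eq)).1 (fun x hx => ?_)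
        (Finset.mem_erase.2 ⟨hav, ha⟩) (Finset.mem_erase.2 ⟨hbv, hb⟩) hab
      have hx' := Finset.mem_erase.1 hx
      exact Finset.mem_of_mem_insert_of_ne (hWU hx'.2) hx'.1
    · refine ih hW (fun x hx => ?_) ha hb hab
      exact Finset.mem_of_mem_insert_of_ne (hWU hx) fun h => hvW (h ▸ hx)

end IsKTreeOn

/-! ### Sub-`k`-trees as vertex sets -/

lemma Subgraph.IsKTree.isKTreeOn {G : SimpleGraph V} {X : G.Subgraph} (h : X.IsKTree k) :
    ∃ W : Finset V, X.verts = ↑W ∧ X.spanningCoe.IsKTreeOn k W := by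
  induction h with
  | base X s hcard hverts hadj =>
    exact ⟨s, hverts, .base s ⟨fun a ha b hb hab => (hadj a b).2 ⟨ha, hb, hab⟩, hcard⟩⟩
  | step X Y hX s v hsub hcard hclique hv hverts hadj ih =>
    obtain ⟨W, hW, ih⟩ := ih
    rw [hW] at hsub hv hverts
    have hvW : v ∉ W := by simpa using hv
    have hsW : s ⊆ W := by simpa using hsub
    refine ⟨insert v W, by rw [hverts, Finset.coe_insert], .step W s v (ih.congr ?_) hsW
      ⟨fun a ha b hb hab => (hadj a b).2 (.inl (hclique a ha b hb hab)), hcard⟩ hvW ?_⟩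
    · intro a ha b hb
      have hav : a ≠ v := fun h => hvW (h ▸ ha)
      have hbv : b ≠ v := fun h => hvW (h ▸ hb)
      simp [hadj, hav, hbv]
    · intro b hb
      have hbv : b ≠ v := fun h => hvW (h ▸ hb)
      have : ¬ X.Adj v b := fun h => hvW (by simpa [hW] using h.fst_mem)
      simp [hadj, hbv, this]

lemma IsKTreeOn.induce_isKTree {G : SimpleGraph V} {W : Finset V} (h : G.IsKTreeOn k W) :
    ((⊤ : G.Subgraph).induce (W : Set V)).IsKTree k := by
  induction h with
  | base W hW =>
    refine .base _ W hW.card_eq rfl fun a b => ?_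
    simp only [Subgraph.induce_adj, Finset.mem_coe, Subgraph.top_adj]
    exact ⟨fun h => ⟨h.1, h.2.1, h.2.2.ne⟩, fun h => ⟨h.1, h.2.1, hW.isClique h.1 h.2.1 h.2.2⟩⟩
  | step W s v hW hs hcl hv hadj ih =>
    refine .step _ _ ih s v (by simpa using hs) hcl.card_eq (fun a ha b hb hab => ?_)
      (by simpa using hv) (by simp) fun a b => ?_
    · exact ⟨hs ha, hs hb, hcl.isClique ha hb hab⟩
    · simp only [Subgraph.induce_adj, Finset.mem_coe, Subgraph.top_adj, Finset.mem_insert]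
      constructor
      · rintro ⟨rfl | ha, rfl | hb, hab⟩
        · exact (G.irrefl hab).elim
        · exact .inr (.inl ⟨rfl, (hadj b hb).1 hab⟩)
        · exact .inr (.inr ⟨(hadj a ha).1 hab.symm, rfl⟩)
        · exact .inl ⟨ha, hb, hab⟩
      · rintro (⟨ha, hb, hab⟩ | ⟨rfl, hb⟩ | ⟨ha, rfl⟩)
        · exact ⟨.inr ha, .inr hb, hab⟩
        · exact ⟨.inl rfl, .inr (hs hb), (hadj b (hs hb)).2 hb⟩
        · exact ⟨.inr (hs ha), .inl rfl, ((hadj a (hs ha)).2 ha).symm⟩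

lemma IsKTree.isKTreeOn_univ [Fintype V] {T : SimpleGraph V} (hT : T.IsKTree k) :
    T.IsKTreeOn k Finset.univ := by
  obtain ⟨U, hU, hTU⟩ := Subgraph.IsKTree.isKTreeOn hT
  have hUu : U = Finset.univ := Finset.coe_injective (by simpa using hU.symm)
  subst hUu
  exact hTU.congr fun a _ b _ => by simp

/-- Inside a `k`-tree, a sub-`k`-tree is determined by its vertex set: it is the subgraph
that this set induces. -/
lemma IsKTree.isKTree_iff [Fintype V] {T : SimpleGraph V} (hT : T.IsKTree k) (X : T.Subgraph) :
    X.IsKTree k ↔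
      ∃ W : Finset V, T.IsKTreeOn k W ∧ X = (⊤ : T.Subgraph).induce (W : Set V) := by
  constructor
  · intro h
    obtain ⟨W, hW, hX⟩ := h.isKTreeOn
    have hadj : ∀ a ∈ W, ∀ b ∈ W, T.Adj a b → X.Adj a b := fun a ha b hb hab =>
      hT.isKTreeOn_univ.adj_of_le X.spanningCoe_le hX (Finset.subset_univ _) ha hb hab
    refine ⟨W, hX.congr fun a ha b hb => ⟨fun h => X.adj_sub h, fun h => hadj a ha b hb h⟩, ?_⟩
    refine Subgraph.ext hW ?_
    ext a b
    simp only [Subgraph.induce_adj, Finset.mem_coe, Subgraph.top_adj]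
    refine ⟨fun h => ?_, fun h => hadj a h.1 b h.2.1 h.2.2⟩
    have ha := h.fst_mem
    have hb := h.snd_mem
    rw [hW] at ha hb
    exact ⟨ha, hb, h.adj_sub⟩
  · rintro ⟨W, hW, rfl⟩
    exact hW.induce_isKTree

end SimpleGraph

namespace SimpleGraph

open scoped Classical

variable {V : Type*} {H : SimpleGraph V} {k : ℕ}

/-! ### Families of sub-`k`-trees and their size statistics -/

section Families

variable [Fintype V]

/-- The vertex sets of the sub-`k`-trees of `H` that contain `A` and avoid `F`. -/
noncomputable def kTreeFamily (H : SimpleGraph V) (k : ℕ) (A F : Finset V) :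
    Finset (Finset V) :=
  Finset.univ.filter fun X => H.IsKTreeOn k X ∧ A ⊆ X ∧ Disjoint X F

/-- The total number of vertices outside `A` in the members of `kTreeFamily H k A F`. -/
noncomputable def excessTotal (H : SimpleGraph V) (k : ℕ) (A F : Finset V) : ℕ :=
  ∑ X ∈ H.kTreeFamily k A F, (X.card - A.card)

lemma mem_kTreeFamily {A F X : Finset V} :
    X ∈ H.kTreeFamily k A F ↔ H.IsKTreeOn k X ∧ A ⊆ X ∧ Disjoint X F := by
  simp [kTreeFamily]

/-- The sizes of the members of a family over a clique `A` have no gaps: below each member `X`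
there are members of every size between `#A` and `#X`. -/
lemma exists_card_eq_of_mem_kTreeFamily {A F X : Finset V} (hkA : k ≤ A.card)
    (hA : H.IsClique (A : Set V)) (hX : X ∈ H.kTreeFamily k A F) {m : ℕ} (hm : A.card ≤ m)
    (hmX : m ≤ X.card) : ∃ Y ∈ H.kTreeFamily k A F, Y.card = m := by
  induction hn : X.card - m generalizing X with
  | zero => exact ⟨X, hX, by omega⟩
  | succ n ih =>
    obtain ⟨h1, h2, h3⟩ := mem_kTreeFamily.1 hX
    have hss : A ⊂ X := h2.ssubset_of_ne fun h => by subst h; omega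
    obtain ⟨v, hv, hvA, he, -⟩ := h1.exists_erase hkA hA hss
    have hc := Finset.card_erase_of_mem hv
    exact ih (mem_kTreeFamily.2 ⟨he, Finset.subset_erase.2 ⟨h2, hvA⟩,
      h3.mono_left (Finset.erase_subset _ _)⟩) (by omega) (by omega)

/-- There are at least as many members smaller than `X` as `X` has vertices outside `A`. -/
lemma card_sub_le_card_filter {A F X : Finset V} (hkA : k ≤ A.card)
    (hA : H.IsClique (A : Set V)) (hX : X ∈ H.kTreeFamily k A F) :
    X.card - A.card ≤ ((H.kTreeFamily k A F).filter fun Y => Y.card < X.card).card := by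
  have hsub : Finset.Ico A.card X.card ⊆
      ((H.kTreeFamily k A F).filter fun Y => Y.card < X.card).image Finset.card := fun m hm => by
    rw [Finset.mem_Ico] at hm
    obtain ⟨Y, hY, rfl⟩ := exists_card_eq_of_mem_kTreeFamily hkA hA hX hm.1 hm.2.le
    exact Finset.mem_image_of_mem _ (Finset.mem_filter.2 ⟨hY, hm.2⟩)
  simpa using (Finset.card_le_card hsub).trans Finset.card_image_le

lemma card_sub_lt_card_kTreeFamily {A F X : Finset V} (hkA : k ≤ A.card)
    (hA : H.IsClique (A : Set V)) (hX : X ∈ H.kTreeFamily k A F) :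
    X.card - A.card < (H.kTreeFamily k A F).card := by
  refine (card_sub_le_card_filter hkA hA hX).trans_lt (Finset.card_lt_card ?_)
  refine (Finset.filter_subset _ _).ssubset_of_ne fun h => ?_
  rw [← h] at hX
  exact lt_irrefl _ (Finset.mem_filter.1 hX).2

/-- The mean number of vertices outside `A` is at most `(N - 1) / 2`, where `N` is the number of
members: the excess of each `X` is bounded by the number of smaller members, and each pair of
members is counted at most once in this way. -/
lemma excessTotal_le {A F : Finset V} (hkA : k ≤ A.card) (hA : H.IsClique (A : Set V)) :
    2 * H.excessTotal k A F ≤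
      (H.kTreeFamily k A F).card * ((H.kTreeFamily k A F).card - 1) := by
  set S := H.kTreeFamily k A F with hS
  have h1 : H.excessTotal k A F ≤ ∑ X ∈ S, (S.filter fun Y => Y.card < X.card).card :=
    Finset.sum_le_sum fun X hX => card_sub_le_card_filter hkA hA hX
  have h2 : ∑ X ∈ S, (S.filter fun Y => Y.card < X.card).card =
      ∑ X ∈ S, (S.filter fun Y => X.card < Y.card).card := by
    simp only [Finset.card_filter]
    rw [Finset.sum_comm]
  calc 2 * H.excessTotal k A F
      ≤ ∑ X ∈ S, ((S.filter fun Y => Y.card < X.card).card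
          + (S.filter fun Y => X.card < Y.card).card) := by
        rw [Finset.sum_add_distrib, ← h2]; omega
    _ ≤ ∑ X ∈ S, (S.card - 1) := by
        refine Finset.sum_le_sum fun X hX => ?_
        rw [← Finset.card_union_of_disjoint, ← Finset.card_erase_of_mem hX]
        · refine Finset.card_le_card fun Y hY => ?_
          simp only [Finset.mem_union, Finset.mem_filter, Finset.mem_erase] at hY ⊢
          refine ⟨?_, by tauto⟩
          rintro rfl
          omega
        · rw [Finset.disjoint_filter]
          intro Y _ h; omega
    _ = S.card * (S.card - 1) := by simp

/-- Members that avoid `v` and members that contain `v`. -/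
lemma kTreeFamily_eq_union (A F : Finset V) (v : V) :
    H.kTreeFamily k A F =
      H.kTreeFamily k A (insert v F) ∪ H.kTreeFamily k (insert v A) F := by
  ext X
  simp only [Finset.mem_union, mem_kTreeFamily, Finset.disjoint_insert_right,
    Finset.insert_subset_iff]
  tauto

lemma disjoint_kTreeFamily (A F : Finset V) (v : V) :
    Disjoint (H.kTreeFamily k A (insert v F)) (H.kTreeFamily k (insert v A) F) := by
  rw [Finset.disjoint_left]
  intro X h1 h2
  simp only [mem_kTreeFamily, Finset.disjoint_insert_right, Finset.insert_subset_iff] at h1 h2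
  tauto

lemma card_kTreeFamily_split (A F : Finset V) (v : V) :
    (H.kTreeFamily k A F).card =
      (H.kTreeFamily k A (insert v F)).card + (H.kTreeFamily k (insert v A) F).card := by
  rw [kTreeFamily_eq_union A F v, Finset.card_union_of_disjoint (disjoint_kTreeFamily A F v)]

lemma excessTotal_split {A : Finset V} (F : Finset V) {v : V} (hv : v ∉ A) :
    H.excessTotal k A F = H.excessTotal k A (insert v F) +
      (H.excessTotal k (insert v A) F + (H.kTreeFamily k (insert v A) F).card) := by
  rw [excessTotal, kTreeFamily_eq_union A F v, Finset.sum_union (disjoint_kTreeFamily A F v),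
    excessTotal, excessTotal, Finset.card_eq_sum_ones (H.kTreeFamily k (insert v A) F),
    ← Finset.sum_add_distrib]
  congr 1
  refine Finset.sum_congr rfl fun X hX => ?_
  have := Finset.card_le_card (mem_kTreeFamily.1 hX).2.1
  rw [Finset.card_insert_of_notMem hv] at this ⊢
  omega

end Families

/-! ### The parts of a `k`-tree around a `(k + 1)`-clique -/

/-- `c` sorts the vertices outside the `(k + 1)`-clique `B` into one part for each vertex of `B`:
the part of `b` has no edges to `b` and none to the other parts, so that it is attached to the
`k`-clique `B \ {b}`. -/
structure IsPartition (H : SimpleGraph V) (B : Finset V) (c : V → V) (W : Finset V) : Prop where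
  mem : ∀ w ∈ W, w ∉ B → c w ∈ B
  not_adj : ∀ w ∈ W, w ∉ B → ¬ H.Adj w (c w)
  eq_of_adj : ∀ w ∈ W, ∀ w' ∈ W, w ∉ B → w' ∉ B → H.Adj w w' → c w = c w'

lemma IsKTreeOn.exists_isPartition {B W : Finset V} (hB : H.IsNClique (k + 1) B)
    (hW : H.IsKTreeOn k W) (hBW : B ⊆ W) : ∃ c, H.IsPartition B c W := by
  refine rooted_induction (P := fun W => ∃ c, H.IsPartition B c W) (by rw [hB.card_eq]; omega)
    hB.isClique ⟨id, ?_⟩ ?_ hW hBW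
  · constructor <;> intros <;> contradiction
  rintro X s v hX hBX hs hcl hv hadj ⟨c, hc⟩
  have hvB : v ∉ B := fun h => hv (hBX h)
  -- It suffices to give a suitable colour `b` to the new vertex `v`.
  suffices h : ∃ b ∈ B, b ∉ s ∧ ∀ y ∈ s, y ∉ B → c y = b by
    obtain ⟨b, hbB, hbs, hb⟩ := h
    refine ⟨Function.update c v b, ?_, ?_, ?_⟩
    · intro w hw hwB
      rcases eq_or_ne w v with rfl | hne
      · simpa using hbB
      · simpa [hne] using hc.mem w (Finset.mem_of_mem_insert_of_ne hw hne) hwB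
    · intro w hw hwB
      rcases eq_or_ne w v with rfl | hne
      · simpa using fun h => hbs ((hadj b (hBX hbB)).1 h)
      · simpa [hne] using hc.not_adj w (Finset.mem_of_mem_insert_of_ne hw hne) hwB
    · intro w hw w' hw' hwB hwB' h
      by_cases hne : w = v <;> by_cases hne' : w' = v
      · rw [hne, hne']
      · subst hne
        simpa [hne'] using (hb w' ((hadj w' (Finset.mem_of_mem_insert_of_ne hw' hne')).1 h)
          hwB').symm
      · subst hne'
        simpa [hne] using hb w ((hadj w (Finset.mem_of_mem_insert_of_ne hw hne)).1 h.symm) hwB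
      · simpa [hne, hne'] using hc.eq_of_adj w (Finset.mem_of_mem_insert_of_ne hw hne) w'
          (Finset.mem_of_mem_insert_of_ne hw' hne') hwB hwB' h
  by_cases hsB : s ⊆ B
  · obtain ⟨b, hb, hbs⟩ := Finset.exists_mem_notMem_of_card_lt_card
      (show s.card < B.card by rw [hB.card_eq, hcl.card_eq]; omega)
    exact ⟨b, hb, hbs, fun y hy hyB => absurd (hsB hy) hyB⟩
  · obtain ⟨y, hy, hyB⟩ := Finset.not_subset.1 hsB
    refine ⟨c y, hc.mem y (hs hy) hyB, fun h => ?_, fun z hz hzB => ?_⟩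
    · refine hc.not_adj y (hs hy) hyB (hcl.isClique hy h fun hh => ?_)
      exact hyB (hh ▸ hc.mem y (hs hy) hyB)
    · rcases eq_or_ne z y with rfl | hne
      · rfl
      · exact hc.eq_of_adj z (hs hz) y (hs hy) hzB hyB (hcl.isClique hz hy hne)

section Parts

variable {B : Finset V} {c : V → V} {b : V}

lemma isNClique_erase (hB : H.IsNClique (k + 1) B) (hb : b ∈ B) :
    H.IsNClique k (B.erase b) :=
  ⟨hB.isClique.subset (Finset.coe_subset.2 (Finset.erase_subset _ _)), by
    rw [Finset.card_erase_of_mem hb, hB.card_eq]; rfl⟩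

lemma isKTreeOn_of_isNClique_succ (hB : H.IsNClique (k + 1) B) : H.IsKTreeOn k B := by
  obtain ⟨b, hb⟩ : B.Nonempty := Finset.card_pos.1 (by rw [hB.card_eq]; omega)
  have he := isNClique_erase hB hb
  rw [← Finset.insert_erase hb]
  refine .step _ _ b (.base _ he) subset_rfl he (Finset.notMem_erase _ _) fun x hx => ?_
  have hx' := Finset.mem_erase.1 hx
  simpa [hx] using hB.isClique hb hx'.2 hx'.1.symm

variable [Fintype V]

/-- The part of the vertices outside `B` that belongs to `b`. -/
noncomputable def part (B : Finset V) (c : V → V) (b : V) : Finset V :=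
  Finset.univ.filter fun w => w ∉ B ∧ c w = b

lemma mem_part {w : V} : w ∈ part B c b ↔ w ∉ B ∧ c w = b := by simp [part]

/-- The trace of a sub-`k`-tree on one part, and what remains when the part is deleted. -/
lemma IsPartition.isKTreeOn_trace (hc : H.IsPartition B c Finset.univ)
    (hB : H.IsNClique (k + 1) B) (hb : b ∈ B) {X : Finset V} (hX : H.IsKTreeOn k X)
    (hBX : B ⊆ X) :
    H.IsKTreeOn k (B.erase b ∪ X ∩ part B c b) ∧ H.IsKTreeOn k (X \ part B c b) := by
  refine IsKTreeOn.rooted_induction (P := fun X => H.IsKTreeOn k (B.erase b ∪ X ∩ part B c b) ∧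
    H.IsKTreeOn k (X \ part B c b)) (by rw [hB.card_eq]; omega)
    hB.isClique ?_ ?_ hX hBX
  · have hd : Disjoint B (part B c b) :=
      Finset.disjoint_left.2 fun w h1 h2 => (mem_part.1 h2).1 h1
    rw [Finset.disjoint_iff_inter_eq_empty.1 hd, Finset.union_empty, hd.sdiff_eq_left]
    exact ⟨.base _ (isNClique_erase hB hb), isKTreeOn_of_isNClique_succ hB⟩
  · rintro X s v hX hBX hs hcl hv hadj ⟨ih1, ih2⟩
    have hvB : v ∉ B := fun h => hv (hBX h)
    have hcol : ∀ y ∈ s, y ∉ B → c y = c v := fun y hy hyB =>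
      hc.eq_of_adj y (by simp) v (by simp) hyB hvB ((hadj y (hs hy)).2 hy).symm
    by_cases hvb : c v = b
    · have hvp : v ∈ part B c b := mem_part.2 ⟨hvB, hvb⟩
      rw [Finset.insert_inter_of_mem hvp, Finset.union_insert, Finset.insert_sdiff_of_mem _ hvp]
      refine ⟨.step _ s v ih1 (fun y hy => ?_) hcl (fun h => ?_) fun y hy => hadj y ?_, ih2⟩
      · by_cases hyB : y ∈ B
        · refine Finset.mem_union_left _ (Finset.mem_erase.2 ⟨?_, hyB⟩)
          rintro rfl
          exact hc.not_adj v (by simp) hvB (hvb ▸ (hadj y (hs hy)).2 hy)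
        · exact Finset.mem_union_right _ (Finset.mem_inter.2 ⟨hs hy, mem_part.2
            ⟨hyB, (hcol y hy hyB).trans hvb⟩⟩)
      · rcases Finset.mem_union.1 h with h | h
        · exact hvB (Finset.mem_of_mem_erase h)
        · exact hv (Finset.mem_inter.1 h).1
      · rcases Finset.mem_union.1 hy with h | h
        · exact hBX (Finset.mem_of_mem_erase h)
        · exact (Finset.mem_inter.1 h).1
    · have hvp : v ∉ part B c b := fun h => hvb (mem_part.1 h).2
      rw [Finset.insert_inter_of_notMem hvp, Finset.insert_sdiff_of_notMem _ hvp]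
      refine ⟨ih1, .step _ s v ih2 (fun y hy => ?_) hcl (fun h => hv (Finset.mem_sdiff.1 h).1)
        fun y hy => hadj y (Finset.mem_sdiff.1 hy).1⟩
      refine Finset.mem_sdiff.2 ⟨hs hy, fun hyp => ?_⟩
      rw [mem_part] at hyp
      exact hvb ((hcol y hy hyp.1).symm.trans hyp.2)

/-- A sub-`k`-tree that contains `B \ {b}` but not `b` lies in the part of `b`. -/
lemma IsPartition.subset_of_notMem (hc : H.IsPartition B c Finset.univ)
    (hB : H.IsNClique (k + 1) B) (hb : b ∈ B) {Y : Finset V} (hY : H.IsKTreeOn k Y)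
    (hBY : B.erase b ⊆ Y) (hbY : b ∉ Y) : Y ⊆ B.erase b ∪ part B c b := by
  have he := isNClique_erase hB hb
  refine IsKTreeOn.rooted_induction (P := fun Y => b ∉ Y → Y ⊆ B.erase b ∪ part B c b)
    he.card_eq.ge he.isClique ?_ ?_ hY hBY hbY
  · exact fun _ => Finset.subset_union_left
  · intro X s v hX hBX hs hcl hv hadj ih hb'
    rw [Finset.mem_insert, not_or] at hb'
    have ih := ih hb'.2
    have hvB : v ∉ B := fun h => hv (hBX (Finset.mem_erase.2 ⟨fun hh => hb'.1 hh.symm, h⟩))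
    refine Finset.insert_subset (Finset.mem_union_right _ (mem_part.2 ⟨hvB, ?_⟩)) ih
    by_cases hsB : s ⊆ B
    · have hse : s = B.erase b := Finset.eq_of_subset_of_card_le
        (Finset.subset_erase.2 ⟨hsB, fun h => hb'.2 (hs h)⟩) (by rw [he.card_eq, hcl.card_eq])
      by_contra hne
      refine hc.not_adj v (by simp) hvB ?_
      have hm : c v ∈ s := by rw [hse]; exact Finset.mem_erase.2 ⟨hne, hc.mem v (by simp) hvB⟩
      exact (hadj _ (hs hm)).2 hm
    · obtain ⟨y, hy, hyB⟩ := Finset.not_subset.1 hsB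
      rw [hc.eq_of_adj v (by simp) y (by simp) hvB hyB ((hadj y (hs hy)).2 hy)]
      rcases Finset.mem_union.1 (ih (hs hy)) with h | h
      · exact absurd (Finset.mem_of_mem_erase h) hyB
      · exact (mem_part.1 h).2

/-- Sub-`k`-trees in one part and outside of it can be glued along `B \ {b}`. -/
lemma IsPartition.isKTreeOn_union (hc : H.IsPartition B c Finset.univ)
    (hB : H.IsNClique (k + 1) B) (hb : b ∈ B) {Y Z : Finset V} (hY : H.IsKTreeOn k Y)
    (hBY : B.erase b ⊆ Y) (hbY : b ∉ Y) (hZ : H.IsKTreeOn k Z) (hBZ : B ⊆ Z)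
    (hZd : Disjoint Z (part B c b)) : H.IsKTreeOn k (Y ∪ Z) := by
  have he := isNClique_erase hB hb
  refine IsKTreeOn.rooted_induction (P := fun Y => b ∉ Y → H.IsKTreeOn k (Y ∪ Z))
    he.card_eq.ge he.isClique (fun _ => ?_) ?_ hY hBY hbY
  · rwa [Finset.union_eq_right.2 ((Finset.erase_subset _ _).trans hBZ)]
  · intro X s v hX hBX hs hcl hv hadj ih hb'
    have hbX : b ∉ X := fun h => hb' (Finset.mem_insert_of_mem h)
    have hvp : v ∈ part B c b := by
      rcases Finset.mem_union.1 (hc.subset_of_notMem hB hb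
        (.step X s v hX hs hcl hv hadj) (hBX.trans (Finset.subset_insert _ _)) hb'
        (Finset.mem_insert_self v X)) with h | h
      · exact absurd (hBX h) hv
      · exact h
    obtain ⟨hvB, hvb⟩ := mem_part.1 hvp
    rw [Finset.insert_union]
    refine .step _ s v (ih hbX) (hs.trans Finset.subset_union_left) hcl
      (fun h => ?_) fun y hy => ?_
    · rcases Finset.mem_union.1 h with h | h
      · exact hv h
      · exact Finset.disjoint_left.1 hZd h hvp
    · by_cases hyX : y ∈ X
      · exact hadj y hyX
      refine iff_of_false (fun hvy => ?_) fun h => hyX (hs h)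
      by_cases hyB : y ∈ B
      · obtain rfl : y = b := by
          by_contra hne
          exact hyX (hBX (Finset.mem_erase.2 ⟨hne, hyB⟩))
        exact hc.not_adj v (by simp) hvB (hvb.symm ▸ hvy)
      · refine Finset.disjoint_left.1 hZd ((Finset.mem_union.1 hy).resolve_left hyX)
          (mem_part.2 ⟨hyB, ?_⟩)
        rw [← hc.eq_of_adj v (by simp) y (by simp) hvB hyB hvy, hvb]

/-- The sub-`k`-trees that contain `B` (and avoid `F`) correspond to pairs consisting of a
sub-`k`-tree over `B \ {b}` that misses `b` and a sub-`k`-tree over `B` that misses the part of `b`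
(and both avoid `F`). -/
lemma IsPartition.kTreeFamily_eq_image (hc : H.IsPartition B c Finset.univ)
    (hB : H.IsNClique (k + 1) B) (hb : b ∈ B) {F : Finset V} (hF : Disjoint B F) :
    H.kTreeFamily k B F =
      (H.kTreeFamily k (B.erase b) (insert b (F ∩ part B c b)) ×ˢ
        H.kTreeFamily k B (F ∪ part B c b)).image fun p => p.1 ∪ p.2 := by
  ext X
  simp only [Finset.mem_image, Finset.mem_product, mem_kTreeFamily, Prod.exists,
    Finset.disjoint_insert_right, Finset.disjoint_union_right]
  constructor
  · rintro ⟨hX, hBX, hXF⟩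
    obtain ⟨h1, h2⟩ := hc.isKTreeOn_trace hB hb hX hBX
    have hBp : Disjoint B (part B c b) :=
      Finset.disjoint_left.2 fun w h1 h2 => (mem_part.1 h2).1 h1
    refine ⟨_, _, ⟨⟨h1, Finset.subset_union_left, ?_, ?_⟩, h2,
      Finset.subset_sdiff.2 ⟨hBX, hBp⟩, hXF.mono_left Finset.sdiff_subset,
      Finset.sdiff_disjoint⟩, ?_⟩
    · simp [mem_part, hb]
    · refine Disjoint.mono_left (Finset.union_subset ?_ Finset.inter_subset_left)
        (hXF.mono_right Finset.inter_subset_left)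
      exact (Finset.erase_subset _ _).trans hBX
    · ext w
      have := @hBX w
      simp only [Finset.mem_union, Finset.mem_inter, Finset.mem_sdiff, Finset.mem_erase]
      tauto
  · rintro ⟨Y, Z, ⟨⟨hY, hBY, hbY, hYF⟩, hZ, hBZ, hZF, hZp⟩, rfl⟩
    refine ⟨hc.isKTreeOn_union hB hb hY hBY hbY hZ hBZ hZp,
      hBZ.trans Finset.subset_union_right, Finset.disjoint_union_left.2 ⟨?_, hZF⟩⟩
    have hsub := hc.subset_of_notMem hB hb hY hBY hbY
    rw [Finset.disjoint_left] at hYF hF ⊢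
    intro w hw hwF
    rcases Finset.mem_union.1 (hsub hw) with h | h
    · exact hF (Finset.mem_of_mem_erase h) hwF
    · exact hYF hw (Finset.mem_inter.2 ⟨hwF, h⟩)

lemma IsPartition.inter_eq_of_mem (hc : H.IsPartition B c Finset.univ)
    (hB : H.IsNClique (k + 1) B) (hb : b ∈ B) {F F' Y Z : Finset V}
    (hY : Y ∈ H.kTreeFamily k (B.erase b) (insert b F'))
    (hZ : Z ∈ H.kTreeFamily k B (F ∪ part B c b)) : Y ∩ Z = B.erase b := by
  simp only [mem_kTreeFamily, Finset.disjoint_insert_right,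
    Finset.disjoint_union_right] at hY hZ
  have hsub := hc.subset_of_notMem hB hb hY.1 hY.2.1 hY.2.2.1
  refine subset_antisymm (fun w hw => ?_)
    (Finset.subset_inter hY.2.1 ((Finset.erase_subset _ _).trans hZ.2.1))
  rw [Finset.mem_inter] at hw
  exact (Finset.mem_union.1 (hsub hw.1)).resolve_right
    (Finset.disjoint_left.1 hZ.2.2.2 hw.2)

lemma IsPartition.injOn_union (hc : H.IsPartition B c Finset.univ)
    (hB : H.IsNClique (k + 1) B) (hb : b ∈ B) (F F' : Finset V) :
    Set.InjOn (fun p : Finset V × Finset V => p.1 ∪ p.2)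
      (H.kTreeFamily k (B.erase b) (insert b F') ×ˢ
        H.kTreeFamily k B (F ∪ part B c b) : Finset _) := by
  -- Both components can be read off from the union.
  have key : ∀ Y Z, Y ∈ H.kTreeFamily k (B.erase b) (insert b F') →
      Z ∈ H.kTreeFamily k B (F ∪ part B c b) →
      Y = B.erase b ∪ (Y ∪ Z) ∩ part B c b ∧ Z = (Y ∪ Z) \ part B c b := by
    intro Y Z hY hZ
    simp only [mem_kTreeFamily, Finset.disjoint_insert_right,
      Finset.disjoint_union_right] at hY hZ
    have hsub := hc.subset_of_notMem hB hb hY.1 hY.2.1 hY.2.2.1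
    have hd := Finset.disjoint_left.1 hZ.2.2.2
    constructor <;> ext w <;> have h1 := @hsub w <;> have h2 := @hd w <;>
      have h3 := @hY.2.1 w <;> have h4 := @hZ.2.1 w <;>
      have h5 : w ∈ part B c b → w ∉ B := fun h => (mem_part.1 h).1 <;>
      simp only [Finset.mem_union, Finset.mem_inter, Finset.mem_sdiff, Finset.mem_erase]
        at h1 h2 h3 h4 ⊢ <;> tauto
  rintro ⟨Y, Z⟩ h ⟨Y', Z'⟩ h' heq
  simp only [Finset.coe_product, Set.mem_prod, Finset.mem_coe] at h h' heq
  obtain ⟨h1, h2⟩ := key Y Z h.1 h.2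
  obtain ⟨h1', h2'⟩ := key Y' Z' h'.1 h'.2
  rw [heq] at h1 h2
  rw [h1, h2, ← h1', ← h2']

lemma IsPartition.card_kTreeFamily (hc : H.IsPartition B c Finset.univ)
    (hB : H.IsNClique (k + 1) B) (hb : b ∈ B) {F : Finset V} (hF : Disjoint B F) :
    (H.kTreeFamily k B F).card =
      (H.kTreeFamily k (B.erase b) (insert b (F ∩ part B c b))).card *
        (H.kTreeFamily k B (F ∪ part B c b)).card := by
  rw [hc.kTreeFamily_eq_image hB hb hF, Finset.card_image_of_injOn (hc.injOn_union hB hb F _),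
    Finset.card_product]

lemma IsPartition.excessTotal (hc : H.IsPartition B c Finset.univ)
    (hB : H.IsNClique (k + 1) B) (hb : b ∈ B) {F : Finset V} (hF : Disjoint B F) :
    H.excessTotal k B F =
      H.excessTotal k (B.erase b) (insert b (F ∩ part B c b)) *
          (H.kTreeFamily k B (F ∪ part B c b)).card +
        (H.kTreeFamily k (B.erase b) (insert b (F ∩ part B c b))).card *
          H.excessTotal k B (F ∪ part B c b) := by
  rw [SimpleGraph.excessTotal, hc.kTreeFamily_eq_image hB hb hF,
    Finset.sum_image (hc.injOn_union hB hb F _)]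
  trans ∑ p ∈ H.kTreeFamily k (B.erase b) (insert b (F ∩ part B c b)) ×ˢ
      H.kTreeFamily k B (F ∪ part B c b),
      ((p.1.card - (B.erase b).card) + (p.2.card - B.card))
  · refine Finset.sum_congr rfl fun p hp => ?_
    rw [Finset.mem_product] at hp
    have h1 := Finset.card_union_add_card_inter p.1 p.2
    rw [hc.inter_eq_of_mem hB hb hp.1 hp.2] at h1
    have h2 := Finset.card_le_card (mem_kTreeFamily.1 hp.1).2.1
    have h3 := Finset.card_le_card (mem_kTreeFamily.1 hp.2).2.1
    omega
  · rw [Finset.sum_add_distrib, Finset.sum_product, Finset.sum_product]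
    simp only [Finset.sum_const, smul_eq_mul, SimpleGraph.excessTotal, ← Finset.mul_sum]
    rw [mul_comm]

end Parts

end SimpleGraph

/-! ### The numerical inequality -/

/-- If the comparison of local means `mean_comparison` holds in the presence of a further factor
with `ND` members and mean excess `b`, then it holds without that factor. -/
lemma mean_le_of_mean_le_mul {x q p₁ p' ND b S a : ℝ} (hx : 1 ≤ x) (hq : 1 ≤ q)
    (h₁ : 2 * p₁ ≤ x - 1) (h' : 0 ≤ p') (ha : 0 ≤ a) (hD : 1 ≤ ND) (hb : 2 * b ≤ ND - 1)
    (h : (1 + p₁ + p') * (1 + q * (ND * S)) ≤ (1 + (b + a) + p') * (1 + x * q)) :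
    (1 + p₁ + p') * (1 + q * S) ≤ (1 + a + p') * (1 + x * q) := by
  by_contra! hlt
  have hxq : x ≤ x * q := by nlinarith
  have h1 : (1 + p') * (1 + x * q) ≤ (1 + a + p') * (1 + x * q) := by gcongr; linarith
  have h2 : 0 ≤ p' * (x * q) := by positivity
  have h3 : (1 + x * q) / 2 ≤ (1 + p₁ + p') * q * S := by nlinarith
  have h4 := mul_le_mul_of_nonneg_left h3 (sub_nonneg.2 hD)
  have h5 : 2 * b * (1 + x * q) ≤ (ND - 1) * (1 + x * q) := by gcongr
  nlinarith

/-- The comparison of local means with denominators cleared; a nonnegative multiple of `p₁` is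
dropped from the left-hand side. -/
lemma mul_le_of_mean_le {x q p₁ p' S w : ℝ} (hx : 1 ≤ x) (hq : 1 ≤ q) (hp₁ : 0 ≤ p₁)
    (hS : 1 ≤ S)
    (h : (1 + p₁ + p') * (1 + q * (1 + S)) ≤ (1 + S * w / (1 + S) + p') * (1 + x * q)) :
    (1 + p₁ + p') * q * (1 + S) * (1 + S - x) ≤ w * S * (1 + x * q) := by
  have hS1 : 0 < 1 + S := by linarith
  have h1 := mul_le_mul_of_nonneg_right h hS1.le
  have h2 : (1 + S * w / (1 + S) + p') * (1 + x * q) * (1 + S) =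
      ((1 + p') * (1 + S) + S * w) * (1 + x * q) := by
    field_simp
    ring
  rw [h2] at h1
  have h3 : 0 ≤ p₁ * (1 + S) * (1 + x * q) := by positivity
  nlinarith

/-- The case `x = 1` of the comparison: the bound `(N - 1) / 2` on the mean of the other branch is
then attained, which forces that branch to have a trivial factor, too. -/
lemma eq_one_of_mul_le {q y s : ℕ} {p' t₁ t' : ℝ} (hq : 1 ≤ q) (hy : 1 ≤ y) (hys : y ≤ s)
    (hp' : 0 ≤ p') (ht₁' : 2 * t₁ ≤ y - 1) (ht'' : 2 * t' ≤ s - 1)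
    (h : (1 + p') * q * (1 + (y * s : ℝ)) * (y * s) ≤ (1 + t₁ + t') * (y * s) * (1 + q)) :
    q = 1 ∧ y = 1 := by
  have hq' : (1 : ℝ) ≤ q := by exact_mod_cast hq
  have hy' : (1 : ℝ) ≤ y := by exact_mod_cast hy
  have hys' : (y : ℝ) ≤ s := by exact_mod_cast hys
  have hS : (0 : ℝ) < y * s := mul_pos (by linarith) (by linarith)
  have h1 : (1 + p') * q * (1 + (y * s : ℝ)) ≤ (1 + t₁ + t') * (1 + q) := by
    refine le_of_mul_le_mul_right ?_ hS
    linarith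
  have h2 : 0 ≤ ((y : ℝ) - 1) * (s - 1) := mul_nonneg (by linarith) (by linarith)
  have h3 : 0 ≤ p' * q * (1 + (y * s : ℝ)) := by positivity
  have h4 : 2 * (1 + t₁ + t') * (1 + q) ≤ (y + s) * (1 + (q : ℝ)) := by
    gcongr; linarith
  have h5 : ((y : ℝ) + s) * (1 + q) ≤ (1 + y * s) * (1 + q) :=
    mul_le_mul_of_nonneg_right (by linarith) (by linarith)
  have hq1 : (q : ℝ) ≤ 1 := by
    have : (2 * (q : ℝ)) * (1 + y * s) ≤ (1 + q) * (1 + y * s) := by linarith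
    have := le_of_mul_le_mul_right this (by linarith)
    linarith
  obtain rfl : q = 1 := le_antisymm (by exact_mod_cast hq1) hq
  refine ⟨rfl, ?_⟩
  push_cast at *
  by_contra hne
  have hy2 : (2 : ℝ) ≤ y := by exact_mod_cast (show 2 ≤ y by omega)
  nlinarith

/-- The two comparisons exclude each other if the smaller factors `x` and `y` of the branches are at
least `2`. -/
lemma not_mul_le_of_two_le {x q y s : ℕ} {u t₁ t' : ℝ} (hx : 2 ≤ x) (hxq : x ≤ q) (hy : 2 ≤ y)
    (hys : y ≤ s) (hu : 1 ≤ u) (ht : 0 ≤ t₁ + t') (ht₁' : 2 * t₁ ≤ y - 1)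
    (ht'' : 2 * t' ≤ s - 1) (hle : x * q ≤ y * s)
    (h1 : u * q * (1 + (y * s : ℝ)) * (1 + y * s - x) ≤ (1 + t₁ + t') * (y * s) * (1 + x * q))
    (h2 : (1 + t₁ + t') * s * (1 + (x * q : ℝ)) * (1 + x * q - y) ≤ u * (x * q) * (1 + y * s)) :
    False := by
  have hx' : (2 : ℝ) ≤ x := by exact_mod_cast hx
  have hxq' : (x : ℝ) ≤ q := by exact_mod_cast hxq
  have hy' : (2 : ℝ) ≤ y := by exact_mod_cast hy
  have hys' : (y : ℝ) ≤ s := by exact_mod_cast hys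
  have hle' : (x * q : ℝ) ≤ y * s := by exact_mod_cast hle
  have hQ : (x * x : ℝ) ≤ x * q := by gcongr
  have hS : (y * y : ℝ) ≤ y * s := by gcongr
  have hxx : 2 * (x : ℝ) ≤ x * x := by gcongr
  have hyy : 2 * (y : ℝ) ≤ y * y := by gcongr
  obtain ⟨w, hw⟩ : ∃ w, w = 1 + t₁ + t' := ⟨_, rfl⟩
  rw [← hw] at h1 h2
  have hw1 : 1 ≤ w := by linarith
  have hq0 : (0 : ℝ) < q := by linarith
  have hs0 : (0 : ℝ) < s := by linarith
  have hSx : 0 < 1 + (y * s : ℝ) - x := by linarith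
  rcases le_or_gt y (x * q) with hyQ | hyQ
  · have hyQ' : (y : ℝ) ≤ x * q := by exact_mod_cast hyQ
    -- The product of the two inequalities no longer involves `u` and `w`.
    have h3 := mul_le_mul h1 h2 (by
      have : 0 ≤ 1 + (x * q : ℝ) - y := by linarith
      positivity) (by positivity)
    have h4 : (1 + (y * s : ℝ) - x) * (1 + x * q - y) ≤ x * y := by
      have hpos : 0 < u * w * q * s * (1 + (y * s : ℝ)) * (1 + x * q) := by positivity
      refine le_of_mul_le_mul_left ?_ hpos
      linarith
    rcases le_or_gt y x with hyx | hyx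
    · have hyx' : (y : ℝ) ≤ x := by exact_mod_cast hyx
      have h5 : ((x : ℝ) + 1) * (y + 1) ≤ (1 + (y * s : ℝ) - x) * (1 + x * q - y) :=
        mul_le_mul (by linarith) (by linarith) (by linarith) hSx.le
      linarith
    · have hyx' : (x : ℝ) + 1 ≤ y := by exact_mod_cast hyx
      have h5 : (1 + (y * y : ℝ) - x) * 1 ≤ (1 + (y * s : ℝ) - x) * (1 + x * q - y) :=
        mul_le_mul (by linarith) (by linarith) (by linarith) hSx.le
      have h6 : (x + 1) * (y : ℝ) ≤ y * y := by gcongr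
      linarith
  · -- Here `h2` is void; as `y` is large, `h1` fails because of `1 + t₁ + t' ≤ s`.
    have hyQ' : (x * q : ℝ) + 1 ≤ y := by exact_mod_cast hyQ
    have hws : w ≤ s := by linarith
    have h3 : (q * (1 + (y * s : ℝ) - x)) * (1 + y * s) ≤ (s * (1 + x * q)) * (1 + y * s) := by
      calc (q * (1 + (y * s : ℝ) - x)) * (1 + y * s)
          = 1 * q * (1 + (y * s : ℝ)) * (1 + y * s - x) := by ring
        _ ≤ u * q * (1 + (y * s : ℝ)) * (1 + y * s - x) := by gcongr
        _ ≤ w * (y * s) * (1 + x * q) := h1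
        _ ≤ s * (1 + y * s) * (1 + x * q) := by gcongr; linarith
        _ = (s * (1 + x * q)) * (1 + y * s) := by ring
    have h4 := le_of_mul_le_mul_right h3 (by positivity)
    have h5 : q * (((x * q : ℝ) + 1) * s) ≤ q * (y * s) := by gcongr
    have h6 : (2 : ℝ) * (((x * q : ℝ) + 1) * s) ≤ q * (((x * q : ℝ) + 1) * s) := by
      gcongr; linarith
    have h7 : ((x * q : ℝ) + 1) * 1 ≤ (x * q + 1) * s := by gcongr; linarith
    linarith

/-- The comparison of local means at two adjacent `k`-cliques `C` and `B \ {u}` of a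
`(k + 1)`-clique `B ⊇ C`. The branch of `C` through `B` has the factor `(x, p₁)` at `B \ {u}` and
the factor `(q, p')` at the `k`-cliques of `B` other than `C` and `B \ {u}`, where `(N, m)` stands
for `N` sub-`k`-trees with mean excess `m`; the other branches have the factor `(NA, a)`. The inequality
says that the local mean at `B \ {u}` is at most the local mean at `C`. -/
lemma mean_comparison {x q p₁ p' NA a : ℝ} (hx : 1 ≤ x) (hq : 1 ≤ q) (hA : 1 ≤ NA)
    (h : (x * p₁ + x * q * NA * (1 + a + p₁ + p')) / (x + x * q * NA) ≤
      (NA * a + x * q * NA * (1 + a + p₁ + p')) / (NA + x * q * NA)) :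
    (1 + p₁ + p') * (1 + q * NA) ≤ (1 + a + p') * (1 + x * q) := by
  rw [div_le_div_iff₀ (by positivity) (by positivity)] at h
  have hpos : 0 < x * NA := by positivity
  refine le_of_mul_le_mul_left ?_ hpos
  linarith

/-- If neither of two branches `(x * q, p₁ + p')` and `(y * s, t₁ + t')` offers an improvement of
the local mean, then both branches and the remaining factor `ND` are as small as possible. -/
lemma eq_one_of_mean_le {x q y s ND : ℕ} {p₁ p' t₁ t' b : ℝ} (hx : 1 ≤ x) (hxq : x ≤ q)
    (hy : 1 ≤ y) (hys : y ≤ s) (hD : 1 ≤ ND) (hp₁ : 0 ≤ p₁) (hp' : 0 ≤ p') (ht₁ : 0 ≤ t₁)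
    (ht' : 0 ≤ t') (hp₁x : 2 * p₁ ≤ x - 1) (hp'q : 2 * p' ≤ q - 1) (ht₁y : 2 * t₁ ≤ y - 1)
    (ht's : 2 * t' ≤ s - 1) (hb : 2 * b ≤ ND - 1)
    (h1 : (1 + p₁ + p') * (1 + q * (ND * (1 + (y * s : ℝ)))) ≤
      (1 + (b + (y * s) * (1 + t₁ + t') / (1 + y * s)) + p') * (1 + x * q))
    (h2 : (1 + t₁ + t') * (1 + s * (ND * (1 + (x * q : ℝ)))) ≤
      (1 + (b + (x * q) * (1 + p₁ + p') / (1 + x * q)) + t') * (1 + y * s)) :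
    x = 1 ∧ q = 1 ∧ y = 1 ∧ s = 1 ∧ ND = 1 := by
  have hx' : (1 : ℝ) ≤ x := by exact_mod_cast hx
  have hq' : (1 : ℝ) ≤ q := by exact_mod_cast hx.trans hxq
  have hy' : (1 : ℝ) ≤ y := by exact_mod_cast hy
  have hs' : (1 : ℝ) ≤ s := by exact_mod_cast hy.trans hys
  have hD' : (1 : ℝ) ≤ ND := by exact_mod_cast hD
  have h1' := mul_le_of_mean_le hx' hq' hp₁ (one_le_mul_of_one_le_of_one_le hy' hs')
    (mean_le_of_mean_le_mul hx' hq' hp₁x hp' (by positivity) hD' hb h1)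
  have h2' := mul_le_of_mean_le hy' hs' ht₁ (one_le_mul_of_one_le_of_one_le hx' hq')
    (mean_le_of_mean_le_mul hy' hs' ht₁y ht' (by positivity) hD' hb h2)
  have hx1 : x = 1 → q = 1 ∧ y = 1 := by
    rintro rfl
    have hp0 : p₁ = 0 := le_antisymm (by push_cast at hp₁x; linarith) hp₁
    subst hp0
    refine eq_one_of_mul_le hxq hy hys hp' ht₁y ht's ?_
    push_cast at h1'
    linarith
  have hy1 : y = 1 → s = 1 ∧ x = 1 := by
    rintro rfl
    have ht0 : t₁ = 0 := le_antisymm (by push_cast at ht₁y; linarith) ht₁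
    subst ht0
    refine eq_one_of_mul_le hys hx hxq ht' hp₁x hp'q ?_
    push_cast at h2'
    linarith
  by_cases hxy : x = 1 ∨ y = 1
  · have hall : x = 1 ∧ q = 1 ∧ y = 1 ∧ s = 1 := by tauto
    obtain ⟨rfl, rfl, rfl, rfl⟩ := hall
    refine ⟨rfl, rfl, rfl, rfl, le_antisymm ?_ hD⟩
    push_cast at *
    have : p₁ = 0 := by linarith
    have : p' = 0 := by linarith
    have : t₁ = 0 := by linarith
    have : t' = 0 := by linarith
    subst p₁ p' t₁ t'
    have : (ND : ℝ) ≤ 1 := by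
      norm_num at h1
      linarith
    exact_mod_cast this
  · exfalso
    rcases le_total (x * q) (y * s) with hle | hle
    · refine not_mul_le_of_two_le (u := 1 + p₁ + p') (by omega) hxq (by omega) hys (by linarith)
        (by linarith) ht₁y ht's hle h1' h2'
    · refine not_mul_le_of_two_le (u := 1 + t₁ + t') (by omega) hys (by omega) hxq (by linarith)
        (by linarith) hp₁x hp'q hle h2' h1'

namespace SimpleGraph

open scoped Classical

variable {V : Type*} {H : SimpleGraph V} {k : ℕ}

/-! ### Local means -/

section LocalMean

lemma injective_induce (T : SimpleGraph V) :
    Function.Injective fun W : Finset V => (⊤ : T.Subgraph).induce (W : Set V) :=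
  fun _ _ h => Finset.coe_injective (congrArg Subgraph.verts h)

variable [Fintype V]

lemma mem_kTreeFamily_self {A F : Finset V} (hA : H.IsKTreeOn k A) (hF : Disjoint A F) :
    A ∈ H.kTreeFamily k A F := mem_kTreeFamily.2 ⟨hA, subset_rfl, hF⟩

lemma IsKTree.localSubKTrees_eq {T : SimpleGraph V} (hT : T.IsKTree k) {C : Finset V} :
    T.localSubKTrees k C = (T.kTreeFamily k C ∅).image
      fun W : Finset V => (⊤ : T.Subgraph).induce (W : Set V) := by
  ext X
  simp only [localSubKTrees, Set.Finite.mem_toFinset, Set.mem_ofPred_eq, Finset.mem_image,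
    mem_kTreeFamily, Finset.disjoint_empty_right, and_true, hT.isKTree_iff]
  constructor
  · rintro ⟨⟨W, hW, rfl⟩, hC⟩
    exact ⟨W, ⟨hW, by simpa using Subgraph.verts_mono hC⟩, rfl⟩
  · rintro ⟨W, ⟨hW, hC⟩, rfl⟩
    exact ⟨⟨W, hW, rfl⟩, Subgraph.induce_mono_right (Finset.coe_subset.2 hC)⟩

lemma IsKTree.localNumber_eq {T : SimpleGraph V} (hT : T.IsKTree k) (C : Finset V) :
    T.localNumber k C = (T.kTreeFamily k C ∅).card := by
  rw [localNumber, hT.localSubKTrees_eq, Finset.card_image_of_injective _ (injective_induce T)]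

lemma IsKTree.localTotal_eq {T : SimpleGraph V} (hT : T.IsKTree k) (C : Finset V) :
    T.localTotal k C = ∑ W ∈ T.kTreeFamily k C ∅, W.card := by
  rw [localTotal, hT.localSubKTrees_eq, Finset.sum_image (injective_induce T).injOn]
  simp

lemma IsKTree.localMean_eq {T : SimpleGraph V} (hT : T.IsKTree k) {C : Finset V}
    (hC : T.IsNClique k C) :
    T.localMean k C = k + (T.excessTotal k C ∅ : ℝ) / (T.kTreeFamily k C ∅).card := by
  have hpos : (0 : ℝ) < (T.kTreeFamily k C ∅).card := by
    exact_mod_cast Finset.card_pos.2 ⟨C, mem_kTreeFamily_self (.base C hC) (by simp)⟩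
  have h : T.localTotal k C =
      k * (T.kTreeFamily k C ∅).card + T.excessTotal k C ∅ := by
    rw [hT.localTotal_eq, excessTotal, mul_comm, ← smul_eq_mul, ← Finset.sum_const,
      ← Finset.sum_add_distrib]
    refine Finset.sum_congr rfl fun W hW => ?_
    have := Finset.card_le_card (mem_kTreeFamily.1 hW).2.1
    rw [hC.card_eq] at this ⊢
    omega
  rw [localMean, h, hT.localNumber_eq]
  push_cast
  field_simp

/-- In a `k`-tree of order `k + 2`, the sub-`k`-trees over `C` other than `C` and the whole graph
have `k + 1` vertices. -/
lemma IsKTree.localMean_of_card_eq {T : SimpleGraph V} (hT : T.IsKTree k)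
    (hn : Fintype.card V = k + 2) {C : Finset V} (hC : T.IsNClique k C) :
    T.localMean k C = k + 1 := by
  have hmem : C ∈ T.kTreeFamily k C ∅ := mem_kTreeFamily_self (.base C hC) (by simp)
  have hne : C ≠ Finset.univ := by
    rintro rfl
    have := hC.card_eq
    rw [Finset.card_univ] at this
    omega
  have hmem' : Finset.univ ∈ (T.kTreeFamily k C ∅).erase C :=
    Finset.mem_erase.2 ⟨hne.symm, mem_kTreeFamily.2 ⟨hT.isKTreeOn_univ, by simp, by simp⟩⟩
  have hpos : (0 : ℝ) < (T.kTreeFamily k C ∅).card := by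
    exact_mod_cast Finset.card_pos.2 ⟨C, hmem⟩
  have h0 : ∑ X ∈ T.kTreeFamily k C ∅, ((X.card - C.card : ℕ) - 1 : ℝ) = 0 := by
    rw [← Finset.add_sum_erase _ _ hmem, ← Finset.add_sum_erase _ _ hmem',
      Finset.sum_eq_zero]
    · rw [hC.card_eq, Finset.card_univ, hn]
      norm_num
    · intro X hX
      simp only [Finset.mem_erase] at hX
      obtain ⟨hXu, hXC, hX⟩ := hX
      have hCX := (mem_kTreeFamily.1 hX).2.1
      have h1 := Finset.card_lt_card (hCX.ssubset_of_ne hXC.symm)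
      have h2 := Finset.card_lt_card ((Finset.subset_univ X).ssubset_of_ne hXu)
      rw [Finset.card_univ, hn] at h2
      have hk := hC.card_eq
      rw [show X.card - C.card = 1 by omega]
      simp
  rw [Finset.sum_sub_distrib] at h0
  rw [hT.localMean_eq hC, excessTotal]
  congr 1
  rw [div_eq_one_iff_eq hpos.ne']
  push_cast [Finset.sum_const, nsmul_eq_mul] at h0 ⊢
  linarith

lemma exists_isNClique_succ (hH : H.IsKTreeOn k Finset.univ) {C : Finset V}
    (hC : H.IsNClique k C) (hn : Fintype.card V ≠ k) :
    ∃ B, H.IsNClique (k + 1) B ∧ C ⊆ B := by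
  have hle : k ≤ Fintype.card V := hH.le_card
  obtain ⟨Y, hY, hYc⟩ := exists_card_eq_of_mem_kTreeFamily (F := ∅) (m := k + 1) hC.card_eq.ge
    hC.isClique (mem_kTreeFamily.2 ⟨hH, Finset.subset_univ C, by simp⟩)
    (by rw [hC.card_eq]; omega) (by rw [Finset.card_univ]; omega)
  obtain ⟨hYT, hCY, -⟩ := mem_kTreeFamily.1 hY
  refine ⟨Y, ?_, hCY⟩
  cases hYT with
  | base _ h => have := h.card_eq; omega
  | step W s v hW hs hcl hv hadj =>
    rw [Finset.card_insert_of_notMem hv] at hYc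
    exact IsKTreeOn.isNClique_insert hs hcl hadj (by omega)

end LocalMean

/-! ### Branches at a clique -/

section Branches

variable [Fintype V]

/-- The data of the branch at the `k`-clique `C` through the `(k + 1)`-clique `insert v C`. For a
`k`-clique `D` of this `(k + 1)`-clique, other than `C`, there are `x` sub-`k`-trees over
`D` that do not contain `insert v C`, with mean excess `p₁`; and the sub-`k`-trees over
`insert v C` within the parts attached to the `k`-cliques other than `C` and `D` are `q` in
number, with mean excess `p'`. -/
structure IsBranch (H : SimpleGraph V) (k : ℕ) (C : Finset V) (v : V) (D : Finset V)
    (x q : ℕ) (p₁ p' : ℝ) : Prop where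
  isNClique : H.IsNClique k D
  one_le : 1 ≤ x
  le : x ≤ q
  nonneg₁ : 0 ≤ p₁
  nonneg' : 0 ≤ p'
  two_mul_le₁ : 2 * p₁ ≤ x - 1
  two_mul_le' : 2 * p' ≤ q - 1
  card_insert : ∀ F : Finset V, (∀ w ∈ F, w ∉ insert v C ∧ ∀ y ∈ C, H.Adj w y) →
    (H.kTreeFamily k (insert v C) F).card = (H.kTreeFamily k C (insert v F)).card * (x * q)
  excess_insert : ∀ F : Finset V, (∀ w ∈ F, w ∉ insert v C ∧ ∀ y ∈ C, H.Adj w y) →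
    (H.excessTotal k (insert v C) F : ℝ) = H.excessTotal k C (insert v F) * (x * q) +
      (H.kTreeFamily k C (insert v F)).card * (x * q * (p₁ + p'))
  card_eq : (H.kTreeFamily k D ∅).card = x + (H.kTreeFamily k (insert v C) ∅).card
  excess_eq : (H.excessTotal k D ∅ : ℝ) = x * p₁ +
    (H.excessTotal k (insert v C) ∅ + (H.kTreeFamily k (insert v C) ∅).card)
  card_univ_lt : Fintype.card V < k + x * q + (H.kTreeFamily k C {v}).card

lemma two_mul_mean_excess_le {A F : Finset V} (hkA : k ≤ A.card) (hA : H.IsClique (A : Set V))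
    (hpos : 1 ≤ (H.kTreeFamily k A F).card) :
    2 * ((H.excessTotal k A F : ℝ) / (H.kTreeFamily k A F).card) ≤
      (H.kTreeFamily k A F).card - 1 := by
  have hpos' : (0 : ℝ) < (H.kTreeFamily k A F).card := by exact_mod_cast hpos
  have h := excessTotal_le (F := F) hkA hA
  have h' : (2 * H.excessTotal k A F : ℝ) ≤ (H.kTreeFamily k A F).card *
      ((H.kTreeFamily k A F).card - 1) := by
    rw [← Nat.cast_pred hpos]
    exact_mod_cast h
  rw [← mul_div_assoc, div_le_iff₀ hpos', mul_comm (_ - 1)]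
  exact h'

/-- For `D` one removes from `insert v C` the vertex of `C` for which the number `x` is least. -/
lemma exists_isBranch (hk : 2 ≤ k) (hH : H.IsKTreeOn k Finset.univ) {C : Finset V}
    (hC : H.IsNClique k C) {v : V} (hv : v ∉ C) (hB : H.IsNClique (k + 1) (insert v C)) :
    ∃ D x q p₁ p', H.IsBranch k C v D x q p₁ p' := by
  obtain ⟨c, hc⟩ := hH.exists_isPartition hB (Finset.subset_univ _)
  set B := insert v C with hBdef
  have hvB : v ∈ B := Finset.mem_insert_self v C
  have hBv : B.erase v = C := Finset.erase_insert hv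
  have hdisj : ∀ b, Disjoint B (part B c b) := fun b =>
    Finset.disjoint_left.2 fun w h1 h2 => (mem_part.1 h2).1 h1
  have hBT : H.IsKTreeOn k B := isKTreeOn_of_isNClique_succ hB
  have hpart : ∀ a b, a ≠ b → part B c a ∩ part B c b = ∅ := fun a b hab => by
    refine Finset.disjoint_iff_inter_eq_empty.1 (Finset.disjoint_left.2 fun w h1 h2 => ?_)
    exact hab ((mem_part.1 h1).2.symm.trans (mem_part.1 h2).2)
  have hCB : ∀ {u}, u ∈ C → u ∈ B := fun h => Finset.mem_insert_of_mem h
  have hne : ∀ {u}, u ∈ C → v ≠ u := fun h hh => hv (hh ▸ h)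
  let f : V → ℕ := fun u => (H.kTreeFamily k (B.erase u) {u}).card
  -- Minimality of `f u`, together with the presence of another `y ∈ C`, gives `x ≤ q`.
  obtain ⟨u, hu, hmin⟩ := C.exists_min_image f
    (Finset.card_pos.1 (by rw [hC.card_eq]; omega))
  obtain ⟨y, hy, hyu⟩ : ∃ y ∈ C, y ≠ u :=
    Finset.exists_mem_ne (by rw [hC.card_eq]; omega) u
  have hvu := hne hu
  have huB := hCB hu
  have heu := isNClique_erase hB huB
  have hprodu : (H.kTreeFamily k B (part B c v)).card =
      f u * (H.kTreeFamily k B (part B c v ∪ part B c u)).card := by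
    have := hc.card_kTreeFamily hB huB (hdisj v)
    rwa [hpart v u hvu, insert_empty_eq] at this
  have hexu := hc.excessTotal hB huB (hdisj v)
  rw [hpart v u hvu, insert_empty_eq] at hexu
  have hdvu : Disjoint B (part B c v ∪ part B c u) :=
    Finset.disjoint_union_right.2 ⟨hdisj v, hdisj u⟩
  have hx1 : 1 ≤ f u := Finset.card_pos.2 ⟨_, mem_kTreeFamily_self (.base _ heu) (by simp)⟩
  have hxq : f u ≤ (H.kTreeFamily k B (part B c v ∪ part B c u)).card := by
    have h1 := hc.card_kTreeFamily hB (hCB hy) hdvu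
    rw [Finset.union_inter_distrib_right, hpart v y (hne hy), hpart u y hyu.symm,
      Finset.union_empty, insert_empty_eq] at h1
    rw [h1]
    refine (hmin y hy).trans (Nat.le_mul_of_pos_right _ (Finset.card_pos.2 ⟨B,
      mem_kTreeFamily_self hBT ?_⟩))
    exact Finset.disjoint_union_right.2 ⟨hdvu, hdisj y⟩
  have hq1 := hx1.trans hxq
  have hx0 : (f u : ℝ) ≠ 0 := by exact_mod_cast (show f u ≠ 0 by omega)
  have hq0 : ((H.kTreeFamily k B (part B c v ∪ part B c u)).card : ℝ) ≠ 0 := by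
    exact_mod_cast (show (H.kTreeFamily k B (part B c v ∪ part B c u)).card ≠ 0 by omega)
  -- A vertex outside `B` that is adjacent to all of `C` can only lie in the part of `v`.
  have hF : ∀ F : Finset V, (∀ w ∈ F, w ∉ B ∧ ∀ y ∈ C, H.Adj w y) →
      Disjoint B F ∧ F ⊆ part B c v := fun F hF => by
    refine ⟨Finset.disjoint_right.2 fun w hw => (hF w hw).1, fun w hw => ?_⟩
    obtain ⟨hwB, hadj⟩ := hF w hw
    refine mem_part.2 ⟨hwB, ?_⟩
    refine (Finset.mem_insert.1 (hc.mem w (Finset.mem_univ _) hwB)).resolve_right fun h => ?_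
    exact hc.not_adj w (Finset.mem_univ _) hwB (hadj _ h)
  refine ⟨B.erase u, f u, (H.kTreeFamily k B (part B c v ∪ part B c u)).card,
    (H.excessTotal k (B.erase u) {u} : ℝ) / f u,
    (H.excessTotal k B (part B c v ∪ part B c u) : ℝ) /
      (H.kTreeFamily k B (part B c v ∪ part B c u)).card,
    heu, hx1, hxq, by positivity, by positivity, ?_, ?_, ?_, ?_, ?_, ?_, ?_⟩
  · exact two_mul_mean_excess_le heu.card_eq.ge heu.isClique hx1
  · exact two_mul_mean_excess_le (by rw [hB.card_eq]; omega) hB.isClique hq1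
  · intro F hFw
    obtain ⟨h1, h2⟩ := hF F hFw
    have := hc.card_kTreeFamily hB hvB h1
    rwa [Finset.inter_eq_left.2 h2, Finset.union_eq_right.2 h2, hBv, hprodu] at this
  · intro F hFw
    obtain ⟨h1, h2⟩ := hF F hFw
    have := hc.excessTotal hB hvB h1
    rw [Finset.inter_eq_left.2 h2, Finset.union_eq_right.2 h2, hBv, hprodu, hexu] at this
    rw [this]
    push_cast
    field_simp
    ring
  · have := card_kTreeFamily_split (H := H) (k := k) (B.erase u) ∅ u
    rwa [insert_empty_eq, Finset.insert_erase huB] at this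
  · have := excessTotal_split (H := H) (k := k) ∅ (Finset.notMem_erase u B)
    rw [insert_empty_eq, Finset.insert_erase huB] at this
    rw [this, mul_div_cancel₀ _ hx0]
    push_cast
    rfl
  · -- The whole graph splits into the part of `v` and the rest.
    obtain ⟨h1, h2⟩ := hc.isKTreeOn_trace hB hvB hH (Finset.subset_univ _)
    rw [Finset.univ_inter, hBv] at h1
    have h3 : C ∪ part B c v ∈ H.kTreeFamily k C {v} := by
      refine mem_kTreeFamily.2 ⟨h1, Finset.subset_union_left, ?_⟩
      simp [hv, mem_part, hvB]
    have h4 : Finset.univ \ part B c v ∈ H.kTreeFamily k B (part B c v) :=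
      mem_kTreeFamily.2 ⟨h2, Finset.subset_sdiff.2 ⟨Finset.subset_univ _, hdisj v⟩,
        Finset.sdiff_disjoint⟩
    have h5 := card_sub_lt_card_kTreeFamily hC.card_eq.ge hC.isClique h3
    have h6 := card_sub_lt_card_kTreeFamily (by rw [hB.card_eq]; omega) hB.isClique h4
    rw [hprodu] at h6
    have hCp : Disjoint C (part B c v) := (hdisj v).mono_left (Finset.subset_insert _ _)
    rw [Finset.card_union_of_disjoint hCp, hC.card_eq] at h5
    rw [Finset.card_sdiff_of_subset (Finset.subset_univ _), hB.card_eq, Finset.card_univ] at h6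
    omega

/-- The comparison of the local means at `C` and at a neighbouring `k`-clique `D`. -/
lemma IsBranch.mean_le {T : SimpleGraph V} (hT : T.IsKTree k) {C D : Finset V} {v : V}
    {x q : ℕ} {p₁ p' : ℝ} (h : T.IsBranch k C v D x q p₁ p') (hC : T.IsNClique k C)
    (hv : v ∉ C) (hmax : T.localMean k D ≤ T.localMean k C) :
    (1 + p₁ + p') * (1 + q * (T.kTreeFamily k C {v}).card) ≤
      (1 + (T.excessTotal k C {v} : ℝ) / (T.kTreeFamily k C {v}).card + p') * (1 + x * q) := by
  have hA : 1 ≤ (T.kTreeFamily k C {v}).card :=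
    Finset.card_pos.2 ⟨C, mem_kTreeFamily_self (.base C hC) (by simpa using hv)⟩
  have hA0 : ((T.kTreeFamily k C {v}).card : ℝ) ≠ 0 := by
    exact_mod_cast (show (T.kTreeFamily k C {v}).card ≠ 0 by omega)
  have hcB := h.card_insert ∅ (by simp)
  have heB := h.excess_insert ∅ (by simp)
  rw [insert_empty_eq] at hcB heB
  have hcC := card_kTreeFamily_split (H := T) (k := k) C ∅ v
  have heC := excessTotal_split (H := T) (k := k) ∅ hv
  rw [insert_empty_eq] at hcC heC
  refine mean_comparison (by exact_mod_cast h.one_le) (by exact_mod_cast h.one_le.trans h.le)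
    (by exact_mod_cast hA) ?_
  rw [hT.localMean_eq h.isNClique, hT.localMean_eq hC, add_le_add_iff_left, h.excess_eq,
    h.card_eq, hcC, heC, hcB] at hmax
  push_cast at hmax
  rw [heB] at hmax
  convert hmax using 2 <;> field_simp <;> ring

/-- Splitting off the branch through `w` from the sub-`k`-trees over `C` that avoid `v`. -/
lemma IsBranch.card_and_mean {T : SimpleGraph V} {C D : Finset V} {v w : V}
    {y s : ℕ} {t₁ t' : ℝ} (h : T.IsBranch k C w D y s t₁ t') (hC : T.IsNClique k C)
    (hv : v ∉ C) (hw : w ∉ C) (hvw : v ≠ w) (hadj : ∀ z ∈ C, T.Adj v z) :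
    (T.kTreeFamily k C {v}).card = (T.kTreeFamily k C {w, v}).card * (1 + y * s) ∧
    (T.excessTotal k C {v} : ℝ) / (T.kTreeFamily k C {v}).card =
      (T.excessTotal k C {w, v} : ℝ) / (T.kTreeFamily k C {w, v}).card +
        (y * s) * (1 + t₁ + t') / (1 + y * s) := by
  have hF : ∀ z ∈ ({v} : Finset V), z ∉ insert w C ∧ ∀ a ∈ C, T.Adj z a := by
    simpa [hv, hvw] using hadj
  have hcB := h.card_insert {v} hF
  have heB := h.excess_insert {v} hF
  have hcC := card_kTreeFamily_split (H := T) (k := k) C {v} w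
  have heC := excessTotal_split (H := T) (k := k) {v} hw
  have hD : 1 ≤ (T.kTreeFamily k C {w, v}).card :=
    Finset.card_pos.2 ⟨C, mem_kTreeFamily_self (.base C hC) (by simp [hv, hw])⟩
  have hD0 : ((T.kTreeFamily k C {w, v}).card : ℝ) ≠ 0 := by
    exact_mod_cast (show (T.kTreeFamily k C {w, v}).card ≠ 0 by omega)
  have hS : (1 + y * s : ℝ) ≠ 0 := by positivity
  have hc : (T.kTreeFamily k C {v}).card = (T.kTreeFamily k C {w, v}).card * (1 + y * s) := by
    rw [hcC, hcB]; ring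
  refine ⟨hc, ?_⟩
  rw [hc, heC, hcB]
  push_cast
  rw [heB]
  field_simp
  ring

end Branches

end SimpleGraph

theorem mainTheorem1 {V : Type*} [Fintype V] (k : ℕ) (hk : 2 ≤ k)
    (T : SimpleGraph V) (hT : T.IsKTree k) :
    (Fintype.card V ≠ k → Fintype.card V ≠ k + 2 →
      ∀ C : Finset V, T.IsNClique k C →
        (∀ D : Finset V, T.IsNClique k D → T.localMean k D ≤ T.localMean k C) →
        T.cliqueDegree k C = 1) ∧
    (Fintype.card V = k + 2 →
      ∀ C : Finset V, T.IsNClique k C → T.localMean k C = (k : ℝ) + 1) := by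
  classical
  refine ⟨fun hn hn2 C hC hmax => ?_, fun hn C hC => hT.localMean_of_card_eq hn hC⟩
  have hTu := hT.isKTreeOn_univ
  have hpos : 0 < T.cliqueDegree k C := (Set.ncard_pos (Set.toFinite _)).2
    (SimpleGraph.exists_isNClique_succ hTu hC hn)
  by_contra hne
  have htwo : 1 < T.cliqueDegree k C := by omega
  obtain ⟨B₁, B₂, ⟨hB₁, hCB₁⟩, ⟨hB₂, hCB₂⟩, hB⟩ :=
    (Set.one_lt_ncard_iff (Set.toFinite _)).1 htwo
  obtain ⟨v, hv, rfl⟩ := Finset.exists_eq_insert_iff.2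
    ⟨hCB₁, by rw [hC.card_eq, hB₁.card_eq]⟩
  obtain ⟨w, hw, rfl⟩ := Finset.exists_eq_insert_iff.2
    ⟨hCB₂, by rw [hC.card_eq, hB₂.card_eq]⟩
  have hvw : v ≠ w := fun h => hB (by rw [h])
  have hadj : ∀ z, z ∉ C → T.IsNClique (k + 1) (insert z C) → ∀ y ∈ C, T.Adj z y :=
    fun z hz hzB y hy => hzB.isClique (Finset.mem_insert_self z C)
      (Finset.mem_insert_of_mem hy) fun h => hz (h ▸ hy)
  obtain ⟨D, x, q, p₁, p', b₁⟩ := SimpleGraph.exists_isBranch hk hTu hC hv (by convert hB₁)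
  obtain ⟨E, y, s, t₁, t', b₂⟩ := SimpleGraph.exists_isBranch hk hTu hC hw (by convert hB₂)
  have h1 := b₁.mean_le hT hC hv (hmax D b₁.isNClique)
  have h2 := b₂.mean_le hT hC hw (hmax E b₂.isNClique)
  obtain ⟨hcv, hmv⟩ := b₂.card_and_mean hC hv hw hvw (hadj v hv (by convert hB₁))
  obtain ⟨hcw, hmw⟩ := b₁.card_and_mean hC hw hv hvw.symm (hadj w hw (by convert hB₂))
  have hlt := b₁.card_univ_lt
  rw [hmv, hcv] at h1
  rw [hmw, hcw, Finset.pair_comm] at h2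
  rw [hcv] at hlt
  have hD : 1 ≤ (T.kTreeFamily k C {w, v}).card := Finset.card_pos.2
    ⟨C, SimpleGraph.mem_kTreeFamily_self (.base C hC) (by simp [hv, hw])⟩
  push_cast at h1 h2
  obtain ⟨rfl, rfl, rfl, rfl, h⟩ := eq_one_of_mean_le b₁.one_le b₁.le b₂.one_le b₂.le hD
    b₁.nonneg₁ b₁.nonneg' b₂.nonneg₁ b₂.nonneg' b₁.two_mul_le₁ b₁.two_mul_le' b₂.two_mul_le₁
    b₂.two_mul_le' (SimpleGraph.two_mul_mean_excess_le hC.card_eq.ge hC.isClique hD) h1 h2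
  rw [h] at hlt
  have hcard : (insert w (insert v C)).card = k + 2 := by
    rw [Finset.card_insert_of_notMem (by simp [hw, hvw.symm]), hB₁.card_eq]
  have hle := Finset.card_le_univ (insert w (insert v C))
  omega
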